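/- A sequence $C(0), C(1), C(2), \ldots$ of integers is said to be *eventually periodic modulo* $p$ if there is an integer $M>0$ such that $C(n+M)\equiv C(n)\pmod p$ for all sufficiently large $n$. Consider the following fifteen integer sequences $C(n)$, $n\ge 0$, where unless indicated otherwise sums are over all nonnegative integers $k$ (and $l$), $\binom{m}{j}=0$ for integers $j>m\ge 0$, and terms containing $\binom{n}{j}$ with $j>n$ are $0$. The six sporadic solutions of $(n+1)^2u_{n+1}=(an^2+an+b)u_n-cn^2u_{n-1}$: - (a) $\sum_k\binom{n}{k}^3$; - (b) $\sum_k\binom{n}{k}^2\binom{n+k}{n}$; - (c) $\sum_k\binom{n}{k}^2\binom{2k}{k}$; - (d) $\sum_k\binom{n}{k}\binom{2k}{k}\binom{2(n-k)}{n-k}$; - (f) $\sum_k(-1)^k3^{n-3k}\binom{n}{3k}\frac{(3k)!}{k!^3}$; - (g) $\sum_{k,l}(-1)^k8^{n-k}\binom{n}{k}\binom{k}{l}^3$. The nine sporadic solutions of $(n+1)^3u_{n+1}=(2n+1)(an^2+an+b)u_n-n(cn^2+d)u_{n-1}$: - ($\delta$) $\sum_k(-1)^k3^{n-3k}\binom{n}{3k}\binom{n+k}{n}\frac{(3k)!}{k!^3}$;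 - ($\eta$) $\sum_{k=0}^{\lfloor n/5\rfloor}(-1)^k\binom{n}{k}^3\left(\binom{4n-5k-1}{3n}+\binom{4n-5k}{3n}\right)$ for $n\ge 1$, and $1$ for $n=0$; - ($\alpha$) $\sum_k\binom{n}{k}^2\binom{2k}{k}\binom{2(n-k)}{n-k}$; - ($\epsilon$) $\sum_k\binom{n}{k}^2\binom{2k}{n}^2$; - ($\zeta$) $\sum_{k,l}\binom{n}{k}^2\binom{n}{l}\binom{k}{l}\binom{k+l}{n}$; - ($\gamma$) $\sum_k\binom{n}{k}^2\binom{n+k}{n}^2$; - ($s_7$) $\sum_k\binom{n}{k}^2\binom{n+k}{k}\binom{2k}{n}$; - ($s_{10}$) $\sum_k\binom{n}{k}^4$; - ($s_{18}$) $\sum_{k=0}^{\lfloor n/3\rfloor}(-1)^k\binom{n}{k}\binom{2k}{k}\binom{2(n-k)}{n-k}\left[\binom{2n-3k-1}{n}+\binom{2n-3k}{n}\right]$ for $n\ge 1$, and $1$ for $n=0$. None of these fifteen sequences is eventually periodic modulo $p$ for any prime $p>5$. -/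

import Mathlib

open scoped Nat

namespace AperyLike

/-- `C` is eventually periodic modulo `m`: there is a period `M > 0` such that
`C (n + M) ≡ C n (mod m)` for all sufficiently large `n`. -/
def EventuallyPeriodicMod (C : ℕ → ℤ) (m : ℕ) : Prop :=
  ∃ M : ℕ, 0 < M ∧ ∃ N : ℕ, ∀ n : ℕ, N ≤ n → C (n + M) ≡ C n [ZMOD (m : ℤ)]

/-! In the sums below the summation range contains all the indices for which the summand can be
nonzero, and every natural-number subtraction is exact. -/

/-- The quotient `(3 k)! / k! ^ 3` in the definition of `trinomial` is exact. -/
theorem factorial_pow_three_dvd (k : ℕ) : k ! ^ 3 ∣ (3 * k)! := by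
  have h1 : k ! * k ! ∣ (k + k)! := Nat.factorial_mul_factorial_dvd_factorial_add k k
  have h2 : (k + k)! * k ! ∣ (k + k + k)! :=
    Nat.factorial_mul_factorial_dvd_factorial_add (k + k) k
  have h3 : 3 * k = k + k + k := by ring
  rw [h3, pow_succ, pow_two]
  exact (mul_dvd_mul_right h1 _).trans h2

/-- The trinomial coefficient `(3 k)! / k! ^ 3`. -/
def trinomial (k : ℕ) : ℕ := (3 * k)! / k ! ^ 3

/-- Sequence (a). -/
def seqA (n : ℕ) : ℤ := ∑ k ∈ Finset.range (n + 1), (n.choose k : ℤ) ^ 3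

/-- Sequence (b). -/
def seqB (n : ℕ) : ℤ :=
  ∑ k ∈ Finset.range (n + 1), (n.choose k : ℤ) ^ 2 * ((n + k).choose n : ℤ)

/-- Sequence (c). -/
def seqC (n : ℕ) : ℤ :=
  ∑ k ∈ Finset.range (n + 1), (n.choose k : ℤ) ^ 2 * ((2 * k).choose k : ℤ)

/-- Sequence (d). -/
def seqD (n : ℕ) : ℤ :=
  ∑ k ∈ Finset.range (n + 1),
    (n.choose k : ℤ) * ((2 * k).choose k : ℤ) * ((2 * (n - k)).choose (n - k) : ℤ)

/-- Sequence (f). -/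
def seqF (n : ℕ) : ℤ :=
  ∑ k ∈ Finset.range (n / 3 + 1),
    (-1) ^ k * 3 ^ (n - 3 * k) * (n.choose (3 * k) : ℤ) * (trinomial k : ℤ)

/-- Sequence (g). -/
def seqG (n : ℕ) : ℤ :=
  ∑ k ∈ Finset.range (n + 1), ∑ l ∈ Finset.range (k + 1),
    (-1) ^ k * 8 ^ (n - k) * (n.choose k : ℤ) * (k.choose l : ℤ) ^ 3

/-- Sequence (δ), the Almkvist–Zudilin numbers. -/
def seqDelta (n : ℕ) : ℤ :=
  ∑ k ∈ Finset.range (n / 3 + 1),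
    (-1) ^ k * 3 ^ (n - 3 * k) * (n.choose (3 * k) : ℤ) * ((n + k).choose n : ℤ) *
      (trinomial k : ℤ)

/-- Sequence (η), with the initial value `1`. For `n ≥ 1` and `5 k ≤ n` the number
`4 n - 5 k - 1` is nonnegative. -/
def seqEta (n : ℕ) : ℤ :=
  if n = 0 then 1 else
    ∑ k ∈ Finset.range (n / 5 + 1),
      (-1) ^ k * (n.choose k : ℤ) ^ 3 *
        (((4 * n - 5 * k - 1).choose (3 * n) : ℤ) + ((4 * n - 5 * k).choose (3 * n) : ℤ))

/-- Sequence (α). -/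
def seqAlpha (n : ℕ) : ℤ :=
  ∑ k ∈ Finset.range (n + 1),
    (n.choose k : ℤ) ^ 2 * ((2 * k).choose k : ℤ) * ((2 * (n - k)).choose (n - k) : ℤ)

/-- Sequence (ε). -/
def seqEpsilon (n : ℕ) : ℤ :=
  ∑ k ∈ Finset.range (n + 1), (n.choose k : ℤ) ^ 2 * ((2 * k).choose n : ℤ) ^ 2

/-- Sequence (ζ). -/
def seqZeta (n : ℕ) : ℤ :=
  ∑ k ∈ Finset.range (n + 1), ∑ l ∈ Finset.range (n + 1),
    (n.choose k : ℤ) ^ 2 * (n.choose l : ℤ) * (k.choose l : ℤ) * ((k + l).choose n : ℤ)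

/-- Sequence (γ), the Apéry numbers. -/
def seqGamma (n : ℕ) : ℤ :=
  ∑ k ∈ Finset.range (n + 1), (n.choose k : ℤ) ^ 2 * ((n + k).choose n : ℤ) ^ 2

/-- Cooper's sequence `s₇`. -/
def s7 (n : ℕ) : ℤ :=
  ∑ k ∈ Finset.range (n + 1),
    (n.choose k : ℤ) ^ 2 * ((n + k).choose k : ℤ) * ((2 * k).choose n : ℤ)

/-- Cooper's sequence `s₁₀`. -/
def s10 (n : ℕ) : ℤ := ∑ k ∈ Finset.range (n + 1), (n.choose k : ℤ) ^ 4

/-- Cooper's sequence `s₁₈`, with `s₁₈(0) = 1`. For `n ≥ 1` and `3 k ≤ n` the number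
`2 n - 3 k - 1` is nonnegative. -/
def s18 (n : ℕ) : ℤ :=
  if n = 0 then 1 else
    ∑ k ∈ Finset.range (n / 3 + 1),
      (-1) ^ k * (n.choose k : ℤ) * ((2 * k).choose k : ℤ) *
        ((2 * (n - k)).choose (n - k) : ℤ) *
        (((2 * n - 3 * k - 1).choose n : ℤ) + ((2 * n - 3 * k).choose n : ℤ))

/-- The six sporadic solutions of
`(n + 1)² u (n + 1) = (a n² + a n + b) u n - c n² u (n - 1)`. -/
def sporadicTwo : Set (ℕ → ℤ) := {seqA, seqB, seqC, seqD, seqF, seqG}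

/-- The nine sporadic solutions of
`(n + 1)³ u (n + 1) = (2 n + 1) (a n² + a n + b) u n - n (c n² + d) u (n - 1)`. -/
def sporadicThree : Set (ℕ → ℤ) :=
  {seqDelta, seqEta, seqAlpha, seqEpsilon, seqZeta, seqGamma, s7, s10, s18}

end AperyLike

/-! Only a fragment of the Lucas congruence is needed: `C (p * m + d) ≡ C m * C d` modulo `p` for
the last digits `d = 0, 1` (`LucasAtBit`). Digits this small cause no carries when `p > 5`, so
Lucas' theorem applies to the defining sums almost factor by factor.

Suppose `M` is an eventual period. Some `p ^ s * (p ^ (t + 1) - 1)` is a multiple of `M`, with `p ^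
s` as large as desired. Hence `p ^ s * (p ^ (t + 1) * a + 1)` and `p ^ s * (a + 1)` have congruent
values. By the digit congruences these values are `C a * C 1` and `C (a + 1)`, which forces `C (a +
1) ≡ C a * C 1` for every `a` (`LucasAtBit.eq_of_periodic`). The choice `a = 1` or `a = 2`
contradicts this in each case. -/

namespace AperyLike

open Finset

/-! ### Splitting binomial sums along the last base-`p` digit -/

section Lucas

variable {p : ℕ} [hp : Fact p.Prime]

/-- Lucas' theorem for one base-`p` digit, in `ZMod p`. -/
theorem choose_cast_eq {n k a b c d : ℕ} (hn : n = p * a + b) (hk : k = p * c + d)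
    (hb : b < p) (hd : d < p) :
    (n.choose k : ZMod p) = (a.choose c : ZMod p) * (b.choose d : ZMod p) := by
  have h := Choose.choose_modEq_choose_mod_mul_choose_div_nat (p := p) (n := n) (k := k)
  have h' := (ZMod.natCast_eq_natCast_iff _ _ _).2 h
  have hpos := hp.out.pos
  subst hn hk
  rw [Nat.mul_add_mod, Nat.mul_add_mod, Nat.mod_eq_of_lt hb, Nat.mod_eq_of_lt hd,
    Nat.mul_add_div hpos, Nat.mul_add_div hpos, Nat.div_eq_of_lt hb, Nat.div_eq_of_lt hd] at h'
  rw [h']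
  push_cast
  simp only [add_zero]
  ring

theorem sum_range_mul_eq {M : Type*} [AddCommMonoid M] (G : ℕ → M) (q m : ℕ) :
    ∑ k ∈ range (q * m), G k = ∑ i ∈ range m, ∑ j ∈ range q, G (q * i + j) := by
  induction m with
  | zero => simp
  | succ m ih => rw [Nat.mul_succ, sum_range_add, ih, sum_range_succ]

/-- A binomial sum of length `p * m + d` splits, modulo `p`, along the last base-`p` digit. -/
theorem sum_choose_mul (F : ℕ → ZMod p) (m : ℕ) {d : ℕ} (hd : d < p) :
    ∑ k ∈ range (p * m + d + 1), ((p * m + d).choose k : ZMod p) * F k =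
      ∑ i ∈ range (m + 1), (m.choose i : ZMod p) *
        ∑ j ∈ range (d + 1), (d.choose j : ZMod p) * F (p * i + j) := by
  have h1 : ∑ k ∈ range (p * m + d + 1), ((p * m + d).choose k : ZMod p) * F k =
      ∑ k ∈ range (p * (m + 1)), ((p * m + d).choose k : ZMod p) * F k := by
    apply sum_subset
    · intro x hx
      simp only [mem_range, mul_add] at *
      omega
    · intro x _ hx
      simp only [mem_range, not_lt] at hx
      rw [Nat.choose_eq_zero_of_lt (by omega)]
      simp
  rw [h1, sum_range_mul_eq]
  refine sum_congr rfl fun i _ => ?_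
  have h2 : ∑ j ∈ range (d + 1), (d.choose j : ZMod p) * F (p * i + j) =
      ∑ j ∈ range p, (d.choose j : ZMod p) * F (p * i + j) := by
    apply sum_subset
    · intro x hx
      simp only [mem_range] at *
      omega
    · intro x _ hx
      simp only [mem_range, not_lt] at hx
      rw [Nat.choose_eq_zero_of_lt (by omega)]
      simp
  rw [h2, mul_sum]
  refine sum_congr rfl fun j hj => ?_
  rw [choose_cast_eq rfl rfl hd (mem_range.1 hj), mul_assoc]

/-- The Lucas congruence modulo `p` of `C` for a last base-`p` digit equal to `0` or `1`. -/
def LucasAtBit (p : ℕ) (C : ℕ → ℤ) : Prop :=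
  ∀ m d : ℕ, d ≤ 1 → (C (p * m + d) : ZMod p) = C m * C d

/-- Only the sum over the last digit `j` of the index has to factor, not each summand. This weaker
demand is what (η) and `s18` meet. Taking `m > 0` avoids their exceptional value at `0`. -/
theorem lucasAtBit_of_sum {C : ℕ → ℤ} (F : ℕ → ℕ → ZMod p) (h0 : C 0 = 1)
    (hC : ∀ n, 0 < n → (C n : ZMod p) = ∑ k ∈ range (n + 1), (n.choose k : ZMod p) * F n k)
    (hF : ∀ m i d, 0 < m → i ≤ m → d ≤ 1 →
      ∑ j ∈ range (d + 1), (d.choose j : ZMod p) * F (p * m + d) (p * i + j) = F m i * C d) :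
    LucasAtBit p C := by
  intro m d hd
  have := hp.out.two_le
  rcases Nat.eq_zero_or_pos m with rfl | hm
  · simp [h0]
  rw [hC _ (by positivity), sum_choose_mul _ m (by omega), hC m hm, sum_mul]
  refine sum_congr rfl fun i hi => ?_
  rw [hF m i d hm (by simpa [Nat.lt_succ_iff] using hi) hd, mul_assoc]

theorem lucasAtBit_of_mul {C : ℕ → ℤ} (F : ℕ → ℕ → ZMod p)
    (hC : ∀ n, (C n : ZMod p) = ∑ k ∈ range (n + 1), (n.choose k : ZMod p) * F n k)
    (hF : ∀ m i d j, i ≤ m → j ≤ d → d ≤ 1 → F (p * m + d) (p * i + j) = F m i * F d j) :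
    LucasAtBit p C := by
  intro m d hd
  have := hp.out.two_le
  rw [hC, sum_choose_mul _ m (by omega), hC m, hC d, sum_mul_sum]
  refine sum_congr rfl fun i hi => ?_
  rw [mul_sum]
  refine sum_congr rfl fun j hj => ?_
  rw [hF m i d j (by simpa [Nat.lt_succ_iff] using hi) (by simpa [Nat.lt_succ_iff] using hj) hd]
  ring

theorem mul_add_sub {m i d j : ℕ} (q : ℕ) (hi : i ≤ m) (hj : j ≤ d) :
    q * m + d - (q * i + j) = q * (m - i) + (d - j) := by
  obtain ⟨e, rfl⟩ := Nat.exists_eq_add_of_le hi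
  rw [Nat.add_sub_cancel_left, mul_add]
  omega

theorem pow_mul_add (x : ZMod p) (a b : ℕ) : x ^ (p * a + b) = x ^ a * x ^ b := by
  rw [pow_add, pow_mul, ZMod.pow_card]

end Lucas

/-! ### Digit congruences against periodicity -/

section Periodic

variable {p : ℕ} [hp : Fact p.Prime] {C : ℕ → ℤ}

theorem LucasAtBit.mul_pow (h : LucasAtBit p C) (h0 : C 0 = 1) (m s : ℕ) :
    (C (p ^ s * m) : ZMod p) = C m := by
  induction s with
  | zero => simp
  | succ s ih =>
    have := h (p ^ s * m) 0 (by omega)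
    rw [pow_succ', mul_assoc]
    simpa [h0, ih] using this

/-- In base `p` the argument is `a` followed by `t` zeros, a one and `s` zeros; zeros do not change
the value since `C 0 = 1`. -/
theorem LucasAtBit.pow_mul_add_one (h : LucasAtBit p C) (h0 : C 0 = 1) (a s t : ℕ) :
    (C (p ^ s * (p ^ (t + 1) * a + 1)) : ZMod p) = C a * C 1 := by
  rw [h.mul_pow h0, pow_succ', mul_assoc, h _ 1 le_rfl, h.mul_pow h0]

theorem EventuallyPeriodicMod.add_mul {M N : ℕ}
    (h : ∀ n : ℕ, N ≤ n → C (n + M) ≡ C n [ZMOD (p : ℤ)]) (q n : ℕ) (hn : N ≤ n) :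
    (C (n + M * q) : ZMod p) = C n := by
  induction q with
  | zero => simp
  | succ q ih =>
    rw [← ih, Nat.mul_succ, ← add_assoc]
    exact (ZMod.intCast_eq_intCast_iff _ _ _).2 (h _ (by omega))

/-- The differences `p ^ s * (p ^ t - 1)` with `s` and `t` suitable are multiples of any
given period. -/
theorem exists_dvd_pow_mul (p : ℕ) [hp : Fact p.Prime] {M : ℕ} (hM : 0 < M) (N : ℕ) :
    ∃ s t q : ℕ, N ≤ p ^ s ∧ p ^ s * p ^ (t + 1) = p ^ s + M * q := by
  obtain ⟨e, m, hm, rfl⟩ := Nat.exists_eq_pow_mul_and_not_dvd hM.ne' p hp.out.ne_one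
  have hcop : Nat.Coprime p m := (Nat.Prime.coprime_iff_not_dvd hp.out).2 hm
  have hm0 : 0 < m := by
    rcases Nat.eq_zero_or_pos m with rfl | h
    · simp at hm
    · exact h
  have htot := Nat.totient_pos.2 hm0
  have hmod := Nat.ModEq.pow_totient hcop
  have hdvd : m ∣ p ^ m.totient - 1 :=
    (Nat.modEq_iff_dvd' (Nat.one_le_pow _ _ hp.out.pos)).1 hmod.symm
  obtain ⟨c, hc⟩ := hdvd
  have hle : 1 ≤ p ^ m.totient := Nat.one_le_pow _ _ hp.out.pos
  -- The period is `p ^ e * m` with `m` prime to `p`: the factor `p ^ (e + N)` absorbs `p ^ e` and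
  -- exceeds `N`, and Euler's theorem makes `m` divide `p ^ φ(m) - 1`.
  refine ⟨e + N, m.totient - 1, p ^ N * c, ?_, ?_⟩
  · exact (Nat.lt_pow_self hp.out.one_lt).le.trans
      (Nat.pow_le_pow_right hp.out.pos (Nat.le_add_left _ _))
  · have : p ^ m.totient = 1 + m * c := by omega
    rw [Nat.sub_add_cancel htot, this, pow_add]
    ring

theorem LucasAtBit.eq_of_periodic (h : LucasAtBit p C) (h0 : C 0 = 1)
    (hper : EventuallyPeriodicMod C p) (a : ℕ) : (C (a + 1) : ZMod p) = C a * C 1 := by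
  obtain ⟨M, hM, N, hN⟩ := hper
  obtain ⟨s, t, q, hs, hq⟩ := exists_dvd_pow_mul p hM N
  rw [← h.pow_mul_add_one h0 a s t, ← h.mul_pow h0 (a + 1) s]
  have : p ^ s * (p ^ (t + 1) * a + 1) = p ^ s * (a + 1) + M * (q * a) := by
    rw [mul_add, ← mul_assoc, hq]
    ring
  rw [this, EventuallyPeriodicMod.add_mul hN]
  exact hs.trans (Nat.le_mul_of_pos_right _ a.succ_pos)

/-- A sequence with Lucas congruences is not eventually periodic if the values `C (a + 1)` and
`C a * C 1` differ by a unit modulo `p`. -/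
theorem LucasAtBit.not_periodic (h : LucasAtBit p C) (h0 : C 0 = 1) (a : ℕ)
    (hne : ¬ (p : ℤ) ∣ C (a + 1) - C a * C 1) : ¬ EventuallyPeriodicMod C p := by
  intro hper
  apply hne
  rw [← ZMod.intCast_zmod_eq_zero_iff_dvd]
  push_cast
  rw [h.eq_of_periodic h0 hper, sub_self]

/-- Apart from `s10`, each tested difference has only the prime factors 2, 3 and 5. The exponent 5
is dictated by `s7`, whose difference is `48 - 4 ^ 2 = 2 ^ 5`. -/
theorem not_dvd_of_dvd_thirty_pow (hp5 : 5 < p) {D : ℤ} (hD : D ∣ 30 ^ 5) : ¬ (p : ℤ) ∣ D := by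
  intro h
  have h1 : p ∣ 30 ^ 5 := by exact_mod_cast h.trans hD
  have h2 : p ∣ 2 * 3 * 5 := hp.out.dvd_of_dvd_pow h1
  rcases (Nat.Prime.dvd_mul hp.out).1 h2 with h3 | h3
  · rcases (Nat.Prime.dvd_mul hp.out).1 h3 with h4 | h4 <;>
      have := Nat.le_of_dvd (by norm_num) h4 <;> omega
  · have := Nat.le_of_dvd (by norm_num) h3
    omega

end Periodic

/-! ### Sequences whose summands factor digit by digit -/

section Sequences

variable {p : ℕ} [hp : Fact p.Prime]

theorem lucasAtBit_seqA (hp5 : 5 < p) : LucasAtBit p seqA := by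
  refine lucasAtBit_of_mul (fun n k => (n.choose k : ZMod p) ^ 2) (fun n => ?_) ?_
  · simp only [seqA]
    push_cast
    exact sum_congr rfl fun k _ => by ring
  · intro m i d j hi hj hd
    rw [choose_cast_eq rfl rfl (by omega) (by omega)]
    ring

theorem lucasAtBit_s10 (hp5 : 5 < p) : LucasAtBit p s10 := by
  refine lucasAtBit_of_mul (fun n k => (n.choose k : ZMod p) ^ 3) (fun n => ?_) ?_
  · simp only [s10]
    push_cast
    exact sum_congr rfl fun k _ => by ring
  · intro m i d j hi hj hd
    rw [choose_cast_eq rfl rfl (by omega) (by omega)]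
    ring

theorem choose_add_cast_eq (hp5 : 5 < p) {m i d j : ℕ} (hj : j ≤ d) (hd : d ≤ 1) :
    ((p * m + d + (p * i + j)).choose (p * m + d) : ZMod p) =
      ((m + i).choose m : ZMod p) * ((d + j).choose d : ZMod p) :=
  choose_cast_eq (by ring) rfl (by omega) (by omega)

theorem centralBinom_cast_eq (hp5 : 5 < p) {i j : ℕ} (hj : j ≤ 1) :
    ((2 * (p * i + j)).choose (p * i + j) : ZMod p) =
      ((2 * i).choose i : ZMod p) * ((2 * j).choose j : ZMod p) :=
  choose_cast_eq (by ring) rfl (by omega) (by omega)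

theorem choose_two_mul_cast_eq (hp5 : 5 < p) {m i d j : ℕ} (hj : j ≤ d) (hd : d ≤ 1) :
    ((2 * (p * i + j)).choose (p * m + d) : ZMod p) =
      ((2 * i).choose m : ZMod p) * ((2 * j).choose d : ZMod p) :=
  choose_cast_eq (by ring) rfl (by omega) (by omega)

theorem lucasAtBit_seqB (hp5 : 5 < p) : LucasAtBit p seqB := by
  refine lucasAtBit_of_mul (fun n k => (n.choose k : ZMod p) * ((n + k).choose n : ZMod p))
    (fun n => ?_) ?_
  · simp only [seqB]
    push_cast
    exact sum_congr rfl fun k _ => by ring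
  · intro m i d j hi hj hd
    rw [choose_cast_eq rfl rfl (by omega) (by omega), choose_add_cast_eq hp5 hj hd]
    ring

theorem lucasAtBit_seqGamma (hp5 : 5 < p) : LucasAtBit p seqGamma := by
  refine lucasAtBit_of_mul (fun n k => (n.choose k : ZMod p) * ((n + k).choose n : ZMod p) ^ 2)
    (fun n => ?_) ?_
  · simp only [seqGamma]
    push_cast
    exact sum_congr rfl fun k _ => by ring
  · intro m i d j hi hj hd
    rw [choose_cast_eq rfl rfl (by omega) (by omega), choose_add_cast_eq hp5 hj hd]
    ring

theorem lucasAtBit_seqC (hp5 : 5 < p) : LucasAtBit p seqC := by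
  refine lucasAtBit_of_mul (fun n k => (n.choose k : ZMod p) * ((2 * k).choose k : ZMod p))
    (fun n => ?_) ?_
  · simp only [seqC]
    push_cast
    exact sum_congr rfl fun k _ => by ring
  · intro m i d j hi hj hd
    rw [choose_cast_eq rfl rfl (by omega) (by omega), centralBinom_cast_eq hp5 (hj.trans hd)]
    ring

theorem lucasAtBit_seqD (hp5 : 5 < p) : LucasAtBit p seqD := by
  refine lucasAtBit_of_mul
    (fun n k => ((2 * k).choose k : ZMod p) * ((2 * (n - k)).choose (n - k) : ZMod p))
    (fun n => ?_) ?_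
  · simp only [seqD]
    push_cast
    exact sum_congr rfl fun k _ => by ring
  · intro m i d j hi hj hd
    rw [mul_add_sub p hi hj, centralBinom_cast_eq hp5 (hj.trans hd),
      centralBinom_cast_eq hp5 ((Nat.sub_le d j).trans hd)]
    ring

theorem lucasAtBit_seqAlpha (hp5 : 5 < p) : LucasAtBit p seqAlpha := by
  refine lucasAtBit_of_mul
    (fun n k => (n.choose k : ZMod p) * ((2 * k).choose k : ZMod p) *
      ((2 * (n - k)).choose (n - k) : ZMod p))
    (fun n => ?_) ?_
  · simp only [seqAlpha]
    push_cast
    exact sum_congr rfl fun k _ => by ring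
  · intro m i d j hi hj hd
    rw [mul_add_sub p hi hj, centralBinom_cast_eq hp5 (hj.trans hd),
      centralBinom_cast_eq hp5 ((Nat.sub_le d j).trans hd),
      choose_cast_eq rfl rfl (by omega) (by omega)]
    ring

theorem lucasAtBit_seqEpsilon (hp5 : 5 < p) : LucasAtBit p seqEpsilon := by
  refine lucasAtBit_of_mul (fun n k => (n.choose k : ZMod p) * ((2 * k).choose n : ZMod p) ^ 2)
    (fun n => ?_) ?_
  · simp only [seqEpsilon]
    push_cast
    exact sum_congr rfl fun k _ => by ring
  · intro m i d j hi hj hd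
    rw [choose_cast_eq rfl rfl (by omega) (by omega), choose_two_mul_cast_eq hp5 hj hd]
    ring

theorem lucasAtBit_s7 (hp5 : 5 < p) : LucasAtBit p s7 := by
  refine lucasAtBit_of_mul
    (fun n k => (n.choose k : ZMod p) * ((n + k).choose n : ZMod p) *
      ((2 * k).choose n : ZMod p)) (fun n => ?_) ?_
  · simp only [s7]
    push_cast
    exact sum_congr rfl fun k _ => by rw [← Nat.choose_symm_add]; ring
  · intro m i d j hi hj hd
    rw [choose_cast_eq rfl rfl (by omega) (by omega), choose_two_mul_cast_eq hp5 hj hd,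
      choose_add_cast_eq hp5 hj hd]
    ring

theorem neg_one_pow_mul_add (i j : ℕ) :
    (-1 : ZMod p) ^ (p * i + j) = (-1) ^ i * (-1) ^ j :=
  pow_mul_add _ _ _

/-- The inner sum over `l` is sequence (a), whose congruence is already known; the powers factor by
Fermat's little theorem. -/
theorem lucasAtBit_seqG (hp5 : 5 < p) : LucasAtBit p seqG := by
  refine lucasAtBit_of_mul
    (fun n k => (-1 : ZMod p) ^ k * 8 ^ (n - k) * (seqA k : ZMod p)) (fun n => ?_) ?_
  · simp only [seqG, seqA]
    push_cast
    refine sum_congr rfl fun k _ => ?_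
    rw [mul_sum, mul_sum]
    exact sum_congr rfl fun l _ => by ring
  · intro m i d j hi hj hd
    rw [mul_add_sub p hi hj, pow_mul_add, pow_mul_add, lucasAtBit_seqA hp5 i j (hj.trans hd)]
    ring

/-- The inner sum also carries the weight `n.choose l`, so it splits along the last digit of `l` in
the same way. -/
theorem lucasAtBit_seqZeta (hp5 : 5 < p) : LucasAtBit p seqZeta := by
  refine lucasAtBit_of_mul
    (fun n k => (n.choose k : ZMod p) * ∑ l ∈ range (n + 1), (n.choose l : ZMod p) *
      ((k.choose l : ZMod p) * ((k + l).choose n : ZMod p))) (fun n => ?_) ?_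
  · simp only [seqZeta]
    push_cast
    refine sum_congr rfl fun k _ => ?_
    rw [mul_sum, mul_sum]
    exact sum_congr rfl fun l _ => by ring
  · intro m i d j hi hj hd
    rw [choose_cast_eq rfl rfl (by omega) (by omega), sum_choose_mul _ m (by omega)]
    have key : ∀ i' ∈ range (m + 1), (m.choose i' : ZMod p) *
        ∑ j' ∈ range (d + 1), (d.choose j' : ZMod p) *
          (((p * i + j).choose (p * i' + j') : ZMod p) *
            ((p * i + j + (p * i' + j')).choose (p * m + d) : ZMod p)) =
        (m.choose i' : ZMod p) * ((i.choose i' : ZMod p) * ((i + i').choose m : ZMod p)) *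
          ∑ j' ∈ range (d + 1), (d.choose j' : ZMod p) *
            ((j.choose j' : ZMod p) * ((j + j').choose d : ZMod p)) := by
      intro i' _
      rw [mul_sum, mul_sum]
      refine sum_congr rfl fun j' hj' => ?_
      have hj' : j' ≤ d := by simpa [Nat.lt_succ_iff] using hj'
      rw [choose_cast_eq rfl rfl (by omega) (by omega),
        choose_cast_eq (a := i + i') (b := j + j') (by ring) rfl (by omega) (by omega)]
      ring
    rw [sum_congr rfl key, ← sum_mul]
    ring

/-! ### The trinomial sums (f) and (δ) -/

/-- Both sides are the multinomial coefficient `n! / (k! ^ 3 * (n - 3 * k)!)`. The right side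
exhibits the factor `n.choose k` that the digit splitting requires. -/
theorem choose_mul_trinomial (n k : ℕ) :
    n.choose (3 * k) * trinomial k = n.choose k * ((n - k).choose k * (n - k - k).choose k) := by
  have h1 : trinomial k = (3 * k).choose k * (2 * k).choose k := by
    have e1 := Nat.choose_mul_factorial_mul_factorial (show k ≤ 3 * k by omega)
    have e2 := Nat.choose_mul_factorial_mul_factorial (show k ≤ 2 * k by omega)
    rw [show 3 * k - k = 2 * k by omega] at e1
    rw [show 2 * k - k = k by omega] at e2
    refine Nat.div_eq_of_eq_mul_left (by positivity) ?_
    rw [← e1, ← e2]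
    ring
  have h2 := Nat.choose_mul (n := n) (k := 3 * k) (s := k) (by omega)
  have h3 := Nat.choose_mul (n := n - k) (k := 2 * k) (s := k) (by omega)
  rw [show 3 * k - k = 2 * k by omega] at h2
  rw [show 2 * k - k = k by omega] at h3
  rw [h1, ← mul_assoc, h2, mul_assoc, h3]

/-- The summand shared by the sequences (f) and (δ), without its factor `n.choose k`. -/
def cubicTerm (p n k : ℕ) : ZMod p :=
  (-1) ^ k * 3 ^ (n - 3 * k) * (((n - k).choose k : ZMod p) * ((n - k - k).choose k : ZMod p))

theorem cubicTerm_eq_zero {n k : ℕ} (h : n < 3 * k) : cubicTerm p n k = 0 := by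
  rw [cubicTerm, Nat.choose_eq_zero_of_lt (show n - k - k < k by omega)]
  simp

theorem cubicTerm_mul_add (hp5 : 5 < p) {m i d j : ℕ} (hi : i ≤ m) (hj : j ≤ d) (hd : d ≤ 1) :
    cubicTerm p (p * m + d) (p * i + j) = cubicTerm p m i * cubicTerm p d j := by
  rcases lt_or_ge m (3 * i) with h | h
  · rw [cubicTerm_eq_zero h, zero_mul]
    have : p * (m + 1) ≤ p * (3 * i) := Nat.mul_le_mul_left p h
    have e : p * (3 * i) = 3 * (p * i) := by ring
    rw [mul_add] at this
    exact cubicTerm_eq_zero (by omega)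
  · obtain ⟨c, rfl⟩ := Nat.exists_eq_add_of_le h
    have e1 : p * (3 * i + c) + d - p * i = p * (2 * i + c) + d := by
      rw [Nat.sub_eq_iff_eq_add (by nlinarith)]
      ring
    have e2 : p * (2 * i + c) + d - p * i = p * (i + c) + d := by
      rw [Nat.sub_eq_iff_eq_add (by nlinarith)]
      ring
    have e3 : p * (3 * i + c) + d - 3 * (p * i) = p * c + d := by
      rw [Nat.sub_eq_iff_eq_add (by nlinarith)]
      ring
    rcases Nat.eq_zero_or_pos j with rfl | hj0
    · have e1' : 3 * i + c - i = 2 * i + c := by omega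
      have e2' : 2 * i + c - i = i + c := by omega
      have e3' : 3 * i + c - 3 * i = c := by omega
      simp only [cubicTerm, add_zero]
      rw [e1, e2, e3, e1', e2', e3', pow_mul_add, pow_mul,
        ZMod.pow_card, choose_cast_eq (c := i) (d := 0) rfl (add_zero _).symm (by omega) (by omega),
        choose_cast_eq (c := i) (d := 0) rfl (add_zero _).symm (by omega) (by omega)]
      simp
      ring
    · obtain rfl : d = 1 := by omega
      obtain rfl : j = 1 := by omega
      -- Both sides vanish: the upper entry ends in digit 0 and the lower one in digit 1, while
      -- `cubicTerm p 1 1 = 0`.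
      have e4 : p * (3 * i + c) + 1 - (p * i + 1) = p * (2 * i + c) + 0 := by omega
      simp only [cubicTerm]
      rw [e4, choose_cast_eq (a := 2 * i + c) (b := 0) rfl rfl (by omega) (by omega)]
      simp

theorem sum_cubicTerm (g : ℕ → ZMod p) (n : ℕ) :
    ∑ k ∈ range (n / 3 + 1), (-1) ^ k * 3 ^ (n - 3 * k) * (n.choose (3 * k) : ZMod p) *
        g k * (trinomial k : ZMod p) =
      ∑ k ∈ range (n + 1), (n.choose k : ZMod p) * (cubicTerm p n k * g k) := by
  rw [← sum_subset (range_subset_range.2 (show n / 3 + 1 ≤ n + 1 by omega))]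
  · refine sum_congr rfl fun k _ => ?_
    have h : (n.choose (3 * k) : ZMod p) * (trinomial k : ZMod p) =
        (n.choose k : ZMod p) * (((n - k).choose k : ZMod p) * ((n - k - k).choose k : ZMod p)) := by
      exact_mod_cast congrArg (Nat.cast : ℕ → ZMod p) (choose_mul_trinomial n k)
    rw [cubicTerm]
    linear_combination ((-1) ^ k * 3 ^ (n - 3 * k) * g k) * h
  · intro k hk hk'
    simp only [mem_range] at hk hk'
    rw [cubicTerm_eq_zero (by omega)]
    simp

theorem lucasAtBit_seqF (hp5 : 5 < p) : LucasAtBit p seqF := by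
  refine lucasAtBit_of_mul (cubicTerm p) (fun n => ?_) fun m i d j hi hj hd =>
    cubicTerm_mul_add hp5 hi hj hd
  have := sum_cubicTerm (fun _ => (1 : ZMod p)) n
  simp only [mul_one] at this
  rw [← this, seqF]
  push_cast
  rfl

theorem lucasAtBit_seqDelta (hp5 : 5 < p) : LucasAtBit p seqDelta := by
  refine lucasAtBit_of_mul (fun n k => cubicTerm p n k * ((n + k).choose n : ZMod p))
    (fun n => ?_) ?_
  · rw [← sum_cubicTerm (fun k => ((n + k).choose n : ZMod p)) n, seqDelta]
    push_cast
    rfl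
  · intro m i d j hi hj hd
    rw [cubicTerm_mul_add hp5 hi hj hd, choose_add_cast_eq hp5 hj hd]
    ring

/-! ### Sums with borrows: `s18` and (η) -/

theorem choose_prime_sub_one_add (k : ℕ) (hk : k + 1 < p) :
    ((p - 1).choose k : ZMod p) + ((p - 1).choose (k + 1) : ZMod p) = 0 := by
  have h : p ∣ p.choose (k + 1) := hp.out.dvd_choose_self k.succ_ne_zero hk
  obtain ⟨q, hq⟩ := Nat.exists_eq_add_of_le' hp.out.pos
  rw [← Nat.cast_add, show p - 1 = q by omega, ← Nat.choose_succ_succ' q k, ← hq]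
  exact (ZMod.natCast_eq_zero_iff _ _).2 h

theorem choose_prime_sub_two_add (k : ℕ) :
    ((p - 2).choose k : ZMod p) + ((p - 2).choose (k + 1) : ZMod p) =
      ((p - 1).choose (k + 1) : ZMod p) := by
  obtain ⟨q, hq⟩ := Nat.exists_eq_add_of_le' hp.out.two_le
  rw [← Nat.cast_add, show p - 2 = q by omega, show p - 1 = q + 1 by omega,
    ← Nat.choose_succ_succ' q k]

theorem choose_prime_sub_one_one : ((p - 1).choose 1 : ZMod p) = -1 := by
  have := choose_prime_sub_one_add (p := p) 0 hp.out.one_lt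
  simp only [Nat.choose_zero_right, Nat.cast_one] at this
  linear_combination this

theorem choose_prime_sub_two_one : ((p - 2).choose 1 : ZMod p) = -2 := by
  have := choose_prime_sub_two_add (p := p) 0
  rw [choose_prime_sub_one_one] at this
  simp only [Nat.choose_zero_right, Nat.cast_one] at this
  linear_combination this

theorem choose_prime_sub_one_two (h : 5 < p) : ((p - 1).choose 2 : ZMod p) = 1 := by
  linear_combination choose_prime_sub_one_add (p := p) 1 (by omega) -
    choose_prime_sub_one_one (p := p)

theorem choose_prime_sub_one_three (h : 5 < p) : ((p - 1).choose 3 : ZMod p) = -1 := by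
  linear_combination choose_prime_sub_one_add (p := p) 2 (by omega) -
    choose_prime_sub_one_two (p := p) h

theorem choose_prime_sub_two_three (h : 5 < p) : ((p - 2).choose 3 : ZMod p) = -4 := by
  linear_combination choose_prime_sub_two_add (p := p) 2 - choose_prime_sub_two_add (p := p) 1 +
    choose_prime_sub_one_three h - choose_prime_sub_one_two h + choose_prime_sub_two_one (p := p)

/-- The summand of `s₁₈`, without its factor `n.choose k`. -/
def s18Term (p n k : ℕ) : ZMod p :=
  (-1) ^ k * ((2 * k).choose k : ZMod p) * ((2 * (n - k)).choose (n - k) : ZMod p) *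
    (((2 * n - 3 * k - 1).choose n : ZMod p) + ((2 * n - 3 * k).choose n : ZMod p))

theorem s18Term_eq_zero {n k : ℕ} (hn : 0 < n) (h : n < 3 * k) : s18Term p n k = 0 := by
  rw [s18Term, Nat.choose_eq_zero_of_lt (show 2 * n - 3 * k - 1 < n by omega),
    Nat.choose_eq_zero_of_lt (show 2 * n - 3 * k < n by omega)]
  simp

theorem s18_cast_eq_sum {n : ℕ} (hn : 0 < n) :
    (s18 n : ZMod p) = ∑ k ∈ range (n + 1), (n.choose k : ZMod p) * s18Term p n k := by
  rw [← sum_subset (range_subset_range.2 (show n / 3 + 1 ≤ n + 1 by omega)), s18, if_neg hn.ne']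
  · push_cast
    exact sum_congr rfl fun k _ => by rw [s18Term]; ring
  · intro k hk hk'
    simp only [mem_range] at hk hk'
    rw [s18Term_eq_zero hn (by omega), mul_zero]

/-- Single summands do not factor. With `e + 1 = 2 * m - 3 * i` and `d = 1`, the index digit `j = 0`
yields only `(e + 1).choose m`. For `j = 1` a borrow leaves last digits `p - 2` and `p - 1`,
yielding only `e.choose m`. Both get the coefficient `6 = s18 1`, so their sum restores the bracket.
-/
theorem s18Term_mul_add (hp5 : 5 < p) {m i d : ℕ} (hm : 0 < m) (hi : i ≤ m) (hd : d ≤ 1) :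
    ∑ j ∈ range (d + 1), (d.choose j : ZMod p) * s18Term p (p * m + d) (p * i + j) =
      s18Term p m i * s18 d := by
  have hpm : 0 < p * m := Nat.mul_pos hp.out.pos hm
  rcases lt_or_ge m (3 * i) with h | h
  · rw [s18Term_eq_zero hm h, zero_mul]
    refine sum_eq_zero fun j _ => ?_
    have : p * (m + 1) ≤ p * (3 * i) := Nat.mul_le_mul_left p h
    have e : p * (3 * i) = 3 * (p * i) := by ring
    rw [mul_add] at this
    rw [s18Term_eq_zero (by omega) (by omega), mul_zero]
  -- Since `m > 0`, the difference `2 * m - 3 * i` is positive, so subtracting one from it is exact.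
  · obtain ⟨e, he⟩ := Nat.exists_eq_add_of_le (show 3 * i + 1 ≤ 2 * m by omega)
    have hpe : 2 * (p * m) = 3 * (p * i) + p + p * e := by
      linear_combination p * he
    have hpe' : p * (e + 1) = p * e + p := by ring
    have e0 : 2 * m - 3 * i = e + 1 := by omega
    interval_cases d
    · simp only [zero_add, sum_range_one, add_zero, Nat.choose_self, Nat.cast_one, one_mul,
        s18Term, ← Nat.mul_sub]
      rw [e0, Nat.add_sub_cancel,
        choose_cast_eq (n := 2 * (p * m) - 3 * (p * i) - 1) (k := p * m) (a := e) (b := p - 1)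
          (c := m) (d := 0)
          (by omega) (by ring) (by omega) (by omega),
        choose_cast_eq (n := 2 * (p * m) - 3 * (p * i)) (k := p * m) (a := e + 1) (b := 0)
          (c := m) (d := 0)
          (by omega) (by ring) (by omega) (by omega),
        choose_cast_eq (n := 2 * (p * i)) (k := p * i) (a := 2 * i) (b := 0)
          (c := i) (d := 0)
          (by ring) (by ring) (by omega) (by omega),
        choose_cast_eq (n := 2 * (p * (m - i))) (k := p * (m - i)) (a := 2 * (m - i)) (b := 0)
          (c := m - i) (d := 0)
          (by ring) (by ring) (by omega) (by omega), pow_mul, ZMod.pow_card]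
      simp [s18]
    · have hs : s18 1 = 6 := by decide
      rw [sum_range_succ, sum_range_one, hs]
      simp only [s18Term]
      rw [mul_add_sub p hi (Nat.zero_le 1), mul_add_sub p hi le_rfl,
        centralBinom_cast_eq hp5 (Nat.zero_le 1), centralBinom_cast_eq hp5 le_rfl,
        centralBinom_cast_eq hp5 (Nat.zero_le 1), centralBinom_cast_eq hp5 le_rfl,
        choose_cast_eq (n := 2 * (p * m + 1) - 3 * (p * i + 0) - 1) (a := e + 1) (b := 1) (c := m)
          (d := 1) (by omega) (by ring) (by omega) (by omega),
        choose_cast_eq (n := 2 * (p * m + 1) - 3 * (p * i + 0)) (a := e + 1) (b := 2) (c := m)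
          (d := 1) (by omega) (by ring) (by omega) (by omega),
        choose_cast_eq (n := 2 * (p * m + 1) - 3 * (p * i + 1) - 1) (a := e) (b := p - 2) (c := m)
          (d := 1) (by omega) (by ring) (by omega) (by omega),
        choose_cast_eq (n := 2 * (p * m + 1) - 3 * (p * i + 1)) (a := e) (b := p - 1) (c := m)
          (d := 1) (by omega) (by ring) (by omega) (by omega),
        choose_prime_sub_one_one, choose_prime_sub_two_one, e0, Nat.add_sub_cancel,
        neg_one_pow_mul_add, neg_one_pow_mul_add]
      norm_num
      ring

theorem lucasAtBit_s18 (hp5 : 5 < p) : LucasAtBit p s18 :=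
  lucasAtBit_of_sum (s18Term p) rfl (fun _ hn => s18_cast_eq_sum hn)
    fun _ _ _ hm hi hd => s18Term_mul_add hp5 hm hi hd

/-- The summand of (η), without one factor `n.choose k`. -/
def etaTerm (p n k : ℕ) : ZMod p :=
  (-1) ^ k * (n.choose k : ZMod p) ^ 2 *
    (((4 * n - 5 * k - 1).choose (3 * n) : ZMod p) + ((4 * n - 5 * k).choose (3 * n) : ZMod p))

theorem etaTerm_eq_zero {n k : ℕ} (hn : 0 < n) (h : n < 5 * k) : etaTerm p n k = 0 := by
  rw [etaTerm, Nat.choose_eq_zero_of_lt (show 4 * n - 5 * k - 1 < 3 * n by omega),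
    Nat.choose_eq_zero_of_lt (show 4 * n - 5 * k < 3 * n by omega)]
  simp

theorem seqEta_cast_eq_sum {n : ℕ} (hn : 0 < n) :
    (seqEta n : ZMod p) = ∑ k ∈ range (n + 1), (n.choose k : ZMod p) * etaTerm p n k := by
  rw [← sum_subset (range_subset_range.2 (show n / 5 + 1 ≤ n + 1 by omega)), seqEta,
    if_neg hn.ne']
  · push_cast
    exact sum_congr rfl fun k _ => by rw [etaTerm]; ring
  · intro k hk hk'
    simp only [mem_range] at hk hk'
    rw [etaTerm_eq_zero hn (by omega), mul_zero]

/-- The borrow mechanism of `s18` again, with `e + 1 = 4 * m - 5 * i`. For `d = 1` the coefficients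
are `1 + 4` when `j = 0` and `-(-4 - 1)` when `j = 1`, both equal to `seqEta 1`. -/
theorem etaTerm_mul_add (hp5 : 5 < p) {m i d : ℕ} (hm : 0 < m) (hd : d ≤ 1) :
    ∑ j ∈ range (d + 1), (d.choose j : ZMod p) * etaTerm p (p * m + d) (p * i + j) =
      etaTerm p m i * seqEta d := by
  have hpm : 0 < p * m := Nat.mul_pos hp.out.pos hm
  rcases lt_or_ge m (5 * i) with h | h
  · rw [etaTerm_eq_zero hm h, zero_mul]
    refine sum_eq_zero fun j _ => ?_
    have : p * (m + 1) ≤ p * (5 * i) := Nat.mul_le_mul_left p h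
    have e : p * (5 * i) = 5 * (p * i) := by ring
    rw [mul_add] at this
    rw [etaTerm_eq_zero (by omega) (by omega), mul_zero]
  · obtain ⟨e, he⟩ := Nat.exists_eq_add_of_le (show 5 * i + 1 ≤ 4 * m by omega)
    have hpe : 4 * (p * m) = 5 * (p * i) + p + p * e := by
      linear_combination p * he
    have hpe' : p * (e + 1) = p * e + p := by ring
    have e0 : 4 * m - 5 * i = e + 1 := by omega
    interval_cases d
    · simp only [zero_add, sum_range_one, add_zero, Nat.choose_self, Nat.cast_one, one_mul,
        etaTerm]
      rw [e0, Nat.add_sub_cancel,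
        choose_cast_eq (n := 4 * (p * m) - 5 * (p * i) - 1) (a := e) (b := p - 1) (c := 3 * m)
          (d := 0) (by omega) (by ring) (by omega) (by omega),
        choose_cast_eq (n := 4 * (p * m) - 5 * (p * i)) (a := e + 1) (b := 0) (c := 3 * m)
          (d := 0) (by omega) (by ring) (by omega) (by omega),
        choose_cast_eq (n := p * m) (k := p * i) (a := m) (b := 0) (c := i) (d := 0)
          (by ring) (by ring) (by omega) (by omega), pow_mul, ZMod.pow_card]
      simp [seqEta]
    · have hs : seqEta 1 = 5 := by decide
      rw [sum_range_succ, sum_range_one, hs]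
      simp only [etaTerm]
      rw [choose_cast_eq (n := 4 * (p * m + 1) - 5 * (p * i + 0) - 1) (a := e + 1) (b := 3)
          (c := 3 * m) (d := 3) (by omega) (by ring) (by omega) (by omega),
        choose_cast_eq (n := 4 * (p * m + 1) - 5 * (p * i + 0)) (a := e + 1) (b := 4) (c := 3 * m)
          (d := 3) (by omega) (by ring) (by omega) (by omega),
        choose_cast_eq (n := 4 * (p * m + 1) - 5 * (p * i + 1) - 1) (a := e) (b := p - 2)
          (c := 3 * m) (d := 3) (by omega) (by ring) (by omega) (by omega),
        choose_cast_eq (n := 4 * (p * m + 1) - 5 * (p * i + 1)) (a := e) (b := p - 1) (c := 3 * m)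
          (d := 3) (by omega) (by ring) (by omega) (by omega),
        choose_cast_eq (n := p * m + 1) (k := p * i + 0) rfl rfl (by omega) (by omega),
        choose_cast_eq (n := p * m + 1) (k := p * i + 1) rfl rfl (by omega) (by omega),
        choose_prime_sub_one_three hp5, choose_prime_sub_two_three hp5, e0, Nat.add_sub_cancel,
        neg_one_pow_mul_add, neg_one_pow_mul_add, show Nat.choose 4 3 = 4 by rfl]
      norm_num
      ring

theorem lucasAtBit_seqEta (hp5 : 5 < p) : LucasAtBit p seqEta :=
  lucasAtBit_of_sum (etaTerm p) rfl (fun _ hn => seqEta_cast_eq_sum hn)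
    fun _ _ _ hm _ hd => etaTerm_mul_add hp5 hm hd

/-- The difference at `a = 1` is `14`, which fails for `p = 7`; there `a = 2` gives `164 - 18 * 2 =
128`. -/
theorem s10_not_periodic (hp5 : 5 < p) : ¬ EventuallyPeriodicMod s10 p := by
  have h := lucasAtBit_s10 hp5
  by_cases h7 : p = 7
  · refine h.not_periodic rfl 2 ?_
    subst h7
    decide
  · refine h.not_periodic rfl 1 ?_
    rw [show s10 (1 + 1) - s10 1 * s10 1 = 14 by decide]
    intro hdvd
    have h2 : p ∣ 2 * 7 := by exact_mod_cast hdvd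
    rcases (Nat.Prime.dvd_mul hp.out).1 h2 with h3 | h3
    · have := Nat.le_of_dvd (by norm_num) h3
      omega
    · exact h7 ((Nat.prime_dvd_prime_iff_eq hp.out (by norm_num)).1 h3)

end Sequences

end AperyLike

open AperyLike in
theorem corollary5p1 (C : ℕ → ℤ)
    (hC : C ∈ AperyLike.sporadicTwo ∪ AperyLike.sporadicThree)
    (p : ℕ) (hp : p.Prime) (hp5 : 5 < p) :
    ¬ AperyLike.EventuallyPeriodicMod C p := by
  have : Fact p.Prime := ⟨hp⟩
  simp only [sporadicTwo, sporadicThree, Set.mem_union, Set.mem_insert_iff,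
    Set.mem_singleton_iff] at hC
  rcases hC with (rfl | rfl | rfl | rfl | rfl | rfl) |
    (rfl | rfl | rfl | rfl | rfl | rfl | rfl | rfl | rfl)
  · exact (lucasAtBit_seqA hp5).not_periodic rfl 1 (not_dvd_of_dvd_thirty_pow hp5 (by decide))
  · exact (lucasAtBit_seqB hp5).not_periodic rfl 1 (not_dvd_of_dvd_thirty_pow hp5 (by decide))
  · exact (lucasAtBit_seqC hp5).not_periodic rfl 1 (not_dvd_of_dvd_thirty_pow hp5 (by decide))
  · exact (lucasAtBit_seqD hp5).not_periodic rfl 1 (not_dvd_of_dvd_thirty_pow hp5 (by decide))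
  -- For (f) and (δ) the values at 1 and 2 are 3 and 9, so `a = 1` gives difference 0; `a = 2` gives
  -- -6 and -24.
  · exact (lucasAtBit_seqF hp5).not_periodic rfl 2 (not_dvd_of_dvd_thirty_pow hp5 (by decide))
  · exact (lucasAtBit_seqG hp5).not_periodic rfl 1 (not_dvd_of_dvd_thirty_pow hp5 (by decide))
  · exact (lucasAtBit_seqDelta hp5).not_periodic rfl 2 (not_dvd_of_dvd_thirty_pow hp5 (by decide))
  · exact (lucasAtBit_seqEta hp5).not_periodic rfl 1 (not_dvd_of_dvd_thirty_pow hp5 (by decide))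
  · exact (lucasAtBit_seqAlpha hp5).not_periodic rfl 1 (not_dvd_of_dvd_thirty_pow hp5 (by decide))
  · exact (lucasAtBit_seqEpsilon hp5).not_periodic rfl 1
      (not_dvd_of_dvd_thirty_pow hp5 (by decide))
  · exact (lucasAtBit_seqZeta hp5).not_periodic rfl 1 (not_dvd_of_dvd_thirty_pow hp5 (by decide))
  · exact (lucasAtBit_seqGamma hp5).not_periodic rfl 1 (not_dvd_of_dvd_thirty_pow hp5 (by decide))
  · exact (lucasAtBit_s7 hp5).not_periodic rfl 1 (not_dvd_of_dvd_thirty_pow hp5 (by decide))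
  · exact s10_not_periodic hp5
  · exact (lucasAtBit_s18 hp5).not_periodic rfl 1 (not_dvd_of_dvd_thirty_pow hp5 (by decide))
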